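/- Let $\mathcal H\subset\mathbb R$ be an open set with $(-a_0,a_0)\subset\mathcal H\subset(-a,a)$ for some $0<a_0<a<\infty$. Let $J\in C^2_c(\mathbb R)$ satisfy $J\ge 0$, $\{x: J(x)\ne0\}=(-d,d)$ for some $d>0$, $\int_{\mathbb R}J=1$, $J(-x)=J(x)$ for all $x$, and $J(x_1)\ge J(x_2)$ whenever $0\le x_1\le x_2$. Let $u_0\in L^\infty(\mathbb R)$ satisfy $u_0\ge 0$, $u_0=0$ in $\mathcal H$ and $\int_{\mathbb R}u_0(x)(1+x^2)\,dx<\infty$. Put $Lg(x)=\int_{\mathbb R}J(x-y)g(y)\,dy-g(x)$, and let $u\in C\big([0,\infty);L^1(\mathbb R,(1+x^2)\,dx)\big)$ be the solution of $$ \partial_t u=Lu \ \text{ in } (\mathbb R\setminus\mathcal H)\times(0,\infty),\qquad u=0\ \text{ in }\mathcal H\times(0,\infty),\qquad u(\cdot,0)=u_0\ \text{ in }\mathbb R, $$ where $\partial_t u(\cdot,t)$ is the derivative, in $L^1(\mathbb R,(1+x^2)\,dx)$, of the curve $t\mapsto u(\cdot,t)$, and all (in)equalities between functions of $x$ hold almost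 everywhere. Then $\|u(\cdot,t)\|_{L^\infty(\mathbb R)}=O(t^{-1})$: there is a constant $C$ such that $$ \|u(\cdot,t)\|_{L^\infty(\mathbb R)}\le C\,t^{-1}\qquad\text{for all } t>0 . $$ -/

import Mathlib

open MeasureTheory Set

namespace NonlocalHole

/-- The measure `(1 + x²) dx` on the real line. -/
noncomputable def weightedMeasure : Measure ℝ :=
  (volume : Measure ℝ).withDensity (fun x => ENNReal.ofReal (1 + x ^ 2))

/-- The weighted space `L¹(ℝ, (1 + x²) dx)`. -/
abbrev WeightedL1 : Type := Lp ℝ 1 weightedMeasure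

/-- The nonlocal operator `L g = J * g - g`. -/
noncomputable def nonlocalOp (J g : ℝ → ℝ) (x : ℝ) : ℝ :=
  (∫ y, J (x - y) * g y) - g x

/-- Assumptions on the hole: open, and `(-a₀, a₀) ⊆ H ⊆ (-a, a)` with `0 < a₀ < a < ∞`. -/
structure IsHole (H : Set ℝ) : Prop where
  isOpen : IsOpen H
  bounds : ∃ a₀ a : ℝ, 0 < a₀ ∧ a₀ < a ∧ Ioo (-a₀) a₀ ⊆ H ∧ H ⊆ Ioo (-a) a

/-- Assumptions on the kernel: a `C²` even probability density, nonincreasing on `[0, ∞)`,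
and positive exactly on a bounded interval `(-d, d)`. -/
structure IsKernel (J : ℝ → ℝ) : Prop where
  contDiff : ContDiff ℝ 2 J
  nonneg : ∀ x, 0 ≤ J x
  support_eq : ∃ d : ℝ, 0 < d ∧ Function.support J = Ioo (-d) d
  integral_eq_one : ∫ x, J x = 1
  even : ∀ x, J (-x) = J x
  antitoneOn : AntitoneOn J (Ici 0)

/-- Assumptions on the initial datum, which is a class of functions up to null sets. -/
structure IsInitialDatum (H : Set ℝ) (u₀ : ℝ → ℝ) : Prop where
  nonneg : ∀ᵐ x : ℝ, 0 ≤ u₀ x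
  memLp_top : MemLp u₀ ⊤ (volume : Measure ℝ)
  eq_zero_hole : ∀ᵐ x : ℝ, x ∈ H → u₀ x = 0
  integrable_moment : Integrable (fun x : ℝ => u₀ x * (1 + x ^ 2))

/-- `u ∈ C([0, ∞); L¹(ℝ, (1 + x²) dx))` solves `∂ₜ u = L u` in `(ℝ \ H) × (0, ∞)`, `u = 0` in
`H × (0, ∞)`, `u(·, 0) = u₀`. The time derivative is that of a curve in the Banach space
`L¹(ℝ, (1 + x²) dx)`, and identities between its elements hold for almost every `x`.
The values `u t` for `t < 0` play no role. -/
structure IsSolution (H : Set ℝ) (J u₀ : ℝ → ℝ) (u : ℝ → WeightedL1) : Prop where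
  continuousOn : ContinuousOn u (Ici 0)
  initial : ∀ᵐ x : ℝ, u 0 x = u₀ x
  eq_zero_hole : ∀ t : ℝ, 0 < t → ∀ᵐ x : ℝ, x ∈ H → u t x = 0
  equation : ∀ t : ℝ, 0 < t → ∃ v : WeightedL1, HasDerivAt u v t ∧
    ∀ᵐ x : ℝ, x ∉ H → v x = nonlocalOp J (u t) x

end NonlocalHole

namespace NonlocalHole

open Filter Topology Real FourierTransform
open scoped Convolution

variable {J u₀ : ℝ → ℝ} {H : Set ℝ} {u : ℝ → WeightedL1}

/-! Let `A = killedAvg H J`: average with `J`, then set the result to zero in the hole. Since `u`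
vanishes in the hole, so does its derivative, and the problem becomes `u' = A u - u` with `A`
bounded on the weighted space. Hence `u t` is the Poisson average `e^(-t) ∑ t^n / n! • A^n u₀`
(`IsSolution.hasSum`). The Poisson mean of `1 / (n + 1)` is at most `1 / t`, so it suffices that
`A^n u₀ ≤ C / (n + 1)` (`exists_killedAvg_iterate_le`).

Two gains of order `n^(-1/2)` give this. Killing only decreases, so the last half of the steps is
dominated by free convolution, which maps `L¹` to `L^∞` with norm `O(n^(-1/2))`: the Fourier
transform of `J` is Gaussian near the origin and bounded away from modulus one elsewhere
(`exists_avg_iterate_le`).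

During the first half the mass falls to `O(n^(-1/2))`, because the walk killed in the hole is
recurrent. Indeed `|x| + B`, cut off in the hole, is superharmonic for large `B`
(`exists_superharmonic`), so by symmetry of `A` the first moment stays bounded. A density of small
supremum with bounded first moment has little mass; this inequality, iterated over doubling times,
gives the rate (`exists_le_div_sqrt`). -/

/-! ### Fourier transform of the kernel -/

lemma IsKernel.continuous (hJ : IsKernel J) : Continuous J := hJ.contDiff.continuous

lemma IsKernel.hasCompactSupport (hJ : IsKernel J) : HasCompactSupport J := by
  obtain ⟨d, -, hd⟩ := hJ.support_eq
  refine HasCompactSupport.intro (isCompact_Icc (a := -d) (b := d)) fun x hx => ?_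
  by_contra h
  have : x ∈ Function.support J := h
  rw [hd] at this
  exact hx (Ioo_subset_Icc_self this)

lemma IsKernel.integrable (hJ : IsKernel J) : Integrable J :=
  hJ.continuous.integrable_of_hasCompactSupport hJ.hasCompactSupport

lemma IsKernel.integrable_mul (hJ : IsKernel J) {g : ℝ → ℝ} (hg : Continuous g) :
    Integrable fun x => J x * g x :=
  (hJ.continuous.mul hg).integrable_of_hasCompactSupport hJ.hasCompactSupport.mul_right

/-- Integration against an even kernel annihilates odd functions. -/
lemma IsKernel.integral_mul_odd (hJ : IsKernel J) {g : ℝ → ℝ} (hg : ∀ x, g (-x) = -g x) :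
    ∫ x, J x * g x = 0 := by
  have h := integral_neg_eq_self (fun x => J x * g x) volume
  simp only [hJ.even, hg, mul_neg, integral_neg] at h
  linarith

lemma IsKernel.integral_pos_of_ne (hJ : IsKernel J) {g : ℝ → ℝ} (hg : Continuous g)
    (h0 : ∀ x, 0 ≤ g x) {x : ℝ} (hx : J x * g x ≠ 0) : 0 < ∫ x, J x * g x :=
  (hJ.continuous.mul hg).integral_pos_of_hasCompactSupport_nonneg_nonzero
    hJ.hasCompactSupport.mul_right (fun y => mul_nonneg (hJ.nonneg y) (h0 y)) hx

/-- The Fourier transform of the kernel, as a complex-valued function. -/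
noncomputable def kernelFourier (J : ℝ → ℝ) : ℝ → ℂ := 𝓕 fun x => (J x : ℂ)

lemma IsKernel.kernelFourier_eq (hJ : IsKernel J) (ξ : ℝ) :
    kernelFourier J ξ = ((∫ x, J x * cos (2 * π * x * ξ) : ℝ) : ℂ) := by
  have h0 : ∫ x, J x * sin (-2 * π * x * ξ) = 0 :=
    hJ.integral_mul_odd fun x => by rw [← Real.sin_neg]; ring_nf
  have e : ∀ x : ℝ, Complex.exp (↑(-2 * π * x * ξ) * Complex.I) • (J x : ℂ)
      = ((J x * cos (2 * π * x * ξ) : ℝ) : ℂ) + ((J x * sin (-2 * π * x * ξ) : ℝ) : ℂ) * Complex.I := by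
    intro x
    have : cos (2 * π * x * ξ) = cos (-2 * π * x * ξ) := by rw [← Real.cos_neg]; ring_nf
    rw [Complex.exp_mul_I, this, smul_eq_mul]
    push_cast
    ring
  have hc : Integrable fun x => J x * cos (2 * π * x * ξ) := hJ.integrable_mul (by fun_prop)
  have hs : Integrable fun x => J x * sin (-2 * π * x * ξ) := hJ.integrable_mul (by fun_prop)
  rw [kernelFourier, Real.fourier_real_eq_integral_exp_smul]
  simp_rw [e]
  rw [integral_add hc.ofReal (hs.ofReal.mul_const _), integral_mul_const, integral_complex_ofReal,
    integral_complex_ofReal, h0]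
  simp

lemma IsKernel.norm_kernelFourier (hJ : IsKernel J) (ξ : ℝ) :
    ‖kernelFourier J ξ‖ = |∫ x, J x * cos (2 * π * x * ξ)| := by
  rw [hJ.kernelFourier_eq, Complex.norm_real, Real.norm_eq_abs]

lemma IsKernel.continuous_kernelFourier (hJ : IsKernel J) : Continuous (kernelFourier J) :=
  VectorFourier.fourierIntegral_continuous continuous_fourierChar
    (L := innerₗ ℝ) continuous_inner hJ.integrable.ofReal

lemma norm_fourier_le (f : ℝ → ℂ) (ξ : ℝ) : ‖𝓕 f ξ‖ ≤ ∫ x, ‖f x‖ :=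
  VectorFourier.norm_fourierIntegral_le_integral_norm _ _ _ _ _

lemma IsKernel.norm_kernelFourier_le_one (hJ : IsKernel J) (ξ : ℝ) : ‖kernelFourier J ξ‖ ≤ 1 := by
  refine (norm_fourier_le _ ξ).trans_eq ?_
  simp_rw [Complex.norm_real, Real.norm_of_nonneg (hJ.nonneg _), hJ.integral_eq_one]

/-- Away from the origin the Fourier transform of the kernel has modulus less than one. -/
lemma IsKernel.norm_kernelFourier_lt_one (hJ : IsKernel J) {ξ : ℝ} (hξ : ξ ≠ 0) :
    ‖kernelFourier J ξ‖ < 1 := by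
  obtain ⟨d, hd, hs⟩ := hJ.support_eq
  have hξ' : 0 < |ξ| := abs_pos.2 hξ
  -- At this point `J > 0` and the angle `2πx|ξ|` lies in `(0, π/2]`, so `0 ≤ cos < 1`. Both `1 -
  -- cos` and `1 + cos` are then positive where `J` is, which bounds the cosine integral strictly on
  -- both sides.
  set x := min (d / 2) (1 / (4 * |ξ|)) with hx
  have hx0 : 0 < x := lt_min (by linarith) (by positivity)
  have hJx : J x ≠ 0 := by
    have : x ∈ Function.support J := by
      rw [hs]
      exact ⟨by linarith, (min_le_left _ _).trans_lt (by linarith)⟩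
    exact this
  have hang : 2 * π * x * |ξ| ≤ π / 2 := by
    have : x * |ξ| ≤ 1 / 4 := by
      calc x * |ξ| ≤ 1 / (4 * |ξ|) * |ξ| := by gcongr; exact min_le_right _ _
        _ = 1 / 4 := by field_simp
    nlinarith [pi_pos]
  have hcosabs : cos (2 * π * x * ξ) = cos (2 * π * x * |ξ|) := by
    rcases abs_choice ξ with h | h <;> rw [h]
    rw [← Real.cos_neg]; ring_nf
  have hcos0 : 0 ≤ cos (2 * π * x * ξ) := by
    rw [hcosabs]
    exact cos_nonneg_of_neg_pi_div_two_le_of_le (by have := pi_pos; nlinarith [mul_pos hx0 hξ', mul_pos this (mul_pos hx0 hξ')]) hang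
  have hcos1 : cos (2 * π * x * ξ) < 1 := by
    rw [hcosabs, ← Real.cos_zero]
    exact cos_lt_cos_of_nonneg_of_le_pi_div_two le_rfl hang (by positivity)
  have hc : Integrable fun x => J x * cos (2 * π * x * ξ) := hJ.integrable_mul (by fun_prop)
  have h1 : 0 < ∫ x, J x * (1 - cos (2 * π * x * ξ)) :=
    hJ.integral_pos_of_ne (by fun_prop) (fun y => sub_nonneg.2 (cos_le_one _)) (x := x)
      (mul_ne_zero hJx (by linarith))
  have h2 : 0 < ∫ x, J x * (1 + cos (2 * π * x * ξ)) :=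
    hJ.integral_pos_of_ne (by fun_prop) (fun y => by linarith [neg_one_le_cos (2 * π * y * ξ)])
      (x := x) (mul_ne_zero hJx (by linarith))
  simp_rw [mul_sub, mul_one] at h1
  simp_rw [mul_add, mul_one] at h2
  rw [integral_sub hJ.integrable hc, hJ.integral_eq_one] at h1
  rw [integral_add hJ.integrable hc, hJ.integral_eq_one] at h2
  rw [hJ.norm_kernelFourier, abs_lt]
  constructor <;> linarith

/-- Gaussian bound for the Fourier transform of the kernel near the origin. -/
lemma IsKernel.exists_norm_kernelFourier_le_exp (hJ : IsKernel J) :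
    ∃ c r : ℝ, 0 < c ∧ 0 < r ∧ ∀ ξ, |ξ| ≤ r → ‖kernelFourier J ξ‖ ≤ exp (-c * ξ ^ 2) := by
  obtain ⟨d, hd, hs⟩ := hJ.support_eq
  have hS : 0 < ∫ x, J x * x ^ 2 := by
    refine hJ.integral_pos_of_ne (by fun_prop) (fun y => sq_nonneg y) (x := d / 2) ?_
    refine mul_ne_zero ?_ (by positivity)
    have : d / 2 ∈ Function.support J := by rw [hs]; constructor <;> linarith
    exact this
  -- For `|x| ≤ d` and `|ξ| ≤ 1 / (4d)` the angle is at most `π/2`. There cosine is nonnegative, and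
  -- `cos θ ≤ 1 - (2/π²) θ²` at `θ = 2πxξ` produces the factor 8.
  refine ⟨8 * ∫ x, J x * x ^ 2, 1 / (4 * d), by positivity, by positivity, fun ξ hξ => ?_⟩
  have hang : ∀ x, J x ≠ 0 → |2 * π * x * ξ| ≤ π / 2 := by
    intro x hx
    have : x ∈ Function.support J := hx
    rw [hs] at this
    have hx' : |x| ≤ d := abs_le.2 ⟨this.1.le, this.2.le⟩
    have : |x| * |ξ| ≤ 1 / 4 := by
      calc |x| * |ξ| ≤ d * (1 / (4 * d)) := by gcongr
        _ = 1 / 4 := by field_simp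
    rw [abs_mul, abs_mul, abs_of_pos (by positivity : 0 < 2 * π)]
    nlinarith [pi_pos]
  have hc : Integrable fun x => J x * cos (2 * π * x * ξ) := hJ.integrable_mul (by fun_prop)
  have hpos : 0 ≤ ∫ x, J x * cos (2 * π * x * ξ) := by
    refine integral_nonneg fun x => ?_
    by_cases hx : J x = 0
    · simp [hx]
    · exact mul_nonneg (hJ.nonneg x) (cos_nonneg_of_mem_Icc (abs_le.1 (hang x hx)))
  have hle : ∫ x, J x * cos (2 * π * x * ξ) ≤ ∫ x, (J x - J x * x ^ 2 * (8 * ξ ^ 2)) := by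
    refine integral_mono hc (hJ.integrable.sub ((hJ.integrable_mul (by fun_prop)).mul_const _))
      fun x => ?_
    by_cases hx : J x = 0
    · simp [hx]
    · have h := cos_le_one_sub_mul_cos_sq ((hang x hx).trans (by linarith [pi_pos]))
      have e : 2 / π ^ 2 * (2 * π * x * ξ) ^ 2 = 8 * x ^ 2 * ξ ^ 2 := by
        field_simp; ring
      rw [e] at h
      have := mul_le_mul_of_nonneg_left h (hJ.nonneg x)
      simp only
      linarith
  rw [integral_sub hJ.integrable ((hJ.integrable_mul (by fun_prop)).mul_const _),
    integral_mul_const, hJ.integral_eq_one] at hle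
  rw [hJ.norm_kernelFourier, abs_of_nonneg hpos]
  refine hle.trans ?_
  have := add_one_le_exp (-(8 * ∫ x, J x * x ^ 2) * ξ ^ 2)
  linarith

/-- The Fourier transform of the kernel is bounded away from one outside a neighbourhood of the
origin. -/
lemma IsKernel.exists_norm_kernelFourier_le (hJ : IsKernel J) {r : ℝ} (hr : 0 < r) :
    ∃ q : ℝ, 0 ≤ q ∧ q < 1 ∧ ∀ ξ, r ≤ |ξ| → ‖kernelFourier J ξ‖ ≤ q := by
  -- Riemann–Lebesgue handles large frequencies; on the remaining compact set the maximum is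
  -- attained and is less than one.
  have hlim : Tendsto (kernelFourier J) (cocompact ℝ) (𝓝 0) := zero_at_infty_fourier _
  have hev : ∀ᶠ ξ in cocompact ℝ, ‖kernelFourier J ξ‖ < 1 / 2 := by
    have := hlim.norm
    rw [norm_zero] at this
    exact this.eventually_lt_const (by norm_num)
  obtain ⟨K, hK, hK'⟩ := mem_cocompact.1 hev
  have hcomp : IsCompact (K ∩ {ξ | r ≤ |ξ|}) :=
    hK.inter_right (isClosed_le continuous_const continuous_abs)
  by_cases hne : (K ∩ {ξ | r ≤ |ξ|}).Nonempty
  · obtain ⟨ξ₀, hξ₀, hmax⟩ := hcomp.exists_isMaxOn hne hJ.continuous_kernelFourier.norm.continuousOn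
    have hlt : ‖kernelFourier J ξ₀‖ < 1 :=
      hJ.norm_kernelFourier_lt_one (abs_pos.1 (hr.trans_le hξ₀.2))
    refine ⟨max (1 / 2) ‖kernelFourier J ξ₀‖, by positivity, max_lt (by norm_num) hlt,
      fun ξ hξ => ?_⟩
    by_cases hmem : ξ ∈ K
    · exact (hmax ⟨hmem, hξ⟩).trans (le_max_right _ _)
    · exact (le_of_lt (hK' hmem)).trans (le_max_left _ _)
  · refine ⟨1 / 2, by norm_num, by norm_num, fun ξ hξ => ?_⟩
    exact le_of_lt (hK' fun hmem => hne ⟨ξ, hmem, hξ⟩)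

/-- Two derivatives of `J` cost a factor `(2πiξ)²`, and the transform of `J''` is bounded by its
`L¹` norm, so the transform of `J` decays like `1 / (1 + ξ²)`. The `C²` regularity enters here. -/
lemma IsKernel.integrable_kernelFourier (hJ : IsKernel J) : Integrable (kernelFourier J) := by
  have hJc : ContDiff ℝ 2 fun x => (J x : ℂ) := Complex.ofRealCLM.contDiff.comp hJ.contDiff
  have hcs : HasCompactSupport fun x => (J x : ℂ) :=
    hJ.hasCompactSupport.comp_left (g := fun y : ℝ => (y : ℂ)) (by simp)
  have hint : ∀ n : ℕ, (n : ℕ∞) ≤ 2 → Integrable (iteratedDeriv n fun x => (J x : ℂ)) := by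
    intro n hn
    refine (hJc.continuous_iteratedDeriv n (by exact_mod_cast hn)).integrable_of_hasCompactSupport ?_
    rw [iteratedDeriv_eq_iterate]
    clear hn
    induction n with
    | zero => simpa using hcs
    | succ k ih => rw [Function.iterate_succ_apply']; exact ih.deriv
  have h2 := fourier_iteratedDeriv (N := 2) (n := 2) (by exact_mod_cast hJc) hint le_rfl
  set A := ∫ x, ‖iteratedDeriv 2 (fun x => (J x : ℂ)) x‖
  have hb : ∀ ξ, ‖kernelFourier J ξ‖ ≤ (1 + A) * (1 + ξ ^ 2)⁻¹ := by
    intro ξ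
    have h3 := norm_fourier_le (iteratedDeriv 2 fun x => (J x : ℂ)) ξ
    rw [h2] at h3
    have h4 : (2 * π) ^ 2 * ξ ^ 2 * ‖kernelFourier J ξ‖ ≤ A := by
      refine le_trans (le_of_eq ?_) h3
      rw [norm_smul, norm_pow, kernelFourier]
      simp only [norm_mul, Complex.norm_I, Complex.norm_real, Real.norm_eq_abs, mul_one,
        Complex.norm_ofNat, abs_of_pos pi_pos, mul_pow, sq_abs]
    have h5 := hJ.norm_kernelFourier_le_one ξ
    rw [← div_eq_mul_inv, le_div_iff₀ (by positivity)]
    have h6 : 1 ≤ (2 * π) ^ 2 := by nlinarith [pi_gt_three]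
    have h7 : 0 ≤ ξ ^ 2 * ‖kernelFourier J ξ‖ := by positivity
    nlinarith
  exact (integrable_inv_one_add_sq.const_mul (1 + A)).mono'
    hJ.continuous_kernelFourier.aestronglyMeasurable (Eventually.of_forall hb)

/-- Each of the `n + 1` terms `q^k`, `k ≤ n`, is at least `q^n`, and their sum is below the
geometric series. -/
lemma natCast_mul_pow_pred_le {q : ℝ} (h0 : 0 ≤ q) (h1 : q < 1) (n : ℕ) :
    (n + 1) * q ^ n ≤ 1 / (1 - q) := by
  have h : ∑ k ∈ Finset.range (n + 1), q ^ n ≤ ∑ k ∈ Finset.range (n + 1), q ^ k :=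
    Finset.sum_le_sum fun k hk => pow_le_pow_of_le_one h0 h1.le
      (Nat.lt_succ_iff.1 (Finset.mem_range.1 hk))
  have h2 : ∑ k ∈ Finset.range (n + 1), q ^ k ≤ (1 - q)⁻¹ :=
    (summable_geometric_of_lt_one h0 h1).sum_le_tsum _ (fun _ _ => by positivity) |>.trans_eq
      (tsum_geometric_of_lt_one h0 h1)
  simp only [Finset.sum_const, Finset.card_range, nsmul_eq_mul, Nat.cast_add, Nat.cast_one] at h
  rw [one_div]
  exact h.trans h2

/-- Powers of the Fourier transform of the kernel have integrals of order `n ^ (-1/2)`. -/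
lemma IsKernel.exists_integral_norm_kernelFourier_pow_le (hJ : IsKernel J) :
    ∃ C : ℝ, 0 < C ∧ ∀ n : ℕ, 1 ≤ n → Integrable (fun ξ => ‖kernelFourier J ξ‖ ^ n) ∧
      ∫ ξ, ‖kernelFourier J ξ‖ ^ n ≤ C / √n := by
  obtain ⟨c, r, hc, hr, hnear⟩ := hJ.exists_norm_kernelFourier_le_exp
  obtain ⟨q, hq0, hq1, hfar⟩ := hJ.exists_norm_kernelFourier_le hr
  set A := ∫ ξ, ‖kernelFourier J ξ‖ with hA
  have hA0 : 0 ≤ A := integral_nonneg fun _ => norm_nonneg _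
  have hq : 0 < 1 - q := by linarith
  -- The first term is the Gaussian integral `√(π / (nc))` from low frequencies. At high frequencies
  -- one factor is kept for integrability and the others give `q^(n-1)`, which is at most `1 / ((1 -
  -- q) n)`.
  refine ⟨√(π / c) + 1 / (1 - q) * A, by positivity, fun n hn => ?_⟩
  obtain ⟨m, rfl⟩ : ∃ m, n = m + 1 := ⟨n - 1, by omega⟩
  have hgauss : Integrable fun ξ : ℝ => exp (-((m + 1 : ℕ) * c) * ξ ^ 2) :=
    integrable_exp_neg_mul_sq (by positivity)
  have hbd : ∀ ξ, ‖kernelFourier J ξ‖ ^ (m + 1)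
      ≤ exp (-((m + 1 : ℕ) * c) * ξ ^ 2) + q ^ m * ‖kernelFourier J ξ‖ := by
    intro ξ
    rcases le_total |ξ| r with h | h
    · refine le_add_of_le_of_nonneg ?_ (by positivity)
      refine (pow_le_pow_left₀ (norm_nonneg _) (hnear ξ h) _).trans_eq ?_
      rw [← Real.exp_nat_mul]
      ring_nf
    · refine le_add_of_nonneg_of_le (by positivity) ?_
      rw [pow_succ]
      gcongr
      exact hfar ξ h
  have hrhs := hgauss.add (hJ.integrable_kernelFourier.norm.const_mul (q ^ m))
  have hI : Integrable fun ξ => ‖kernelFourier J ξ‖ ^ (m + 1) :=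
    hrhs.mono' (hJ.continuous_kernelFourier.norm.pow _).aestronglyMeasurable
      (Eventually.of_forall fun ξ => by
        rw [Real.norm_of_nonneg (by positivity)]; exact hbd ξ)
  refine ⟨hI, (integral_mono hI hrhs hbd).trans ?_⟩
  simp only [Pi.add_apply]
  rw [integral_add hgauss (hJ.integrable_kernelFourier.norm.const_mul (q ^ m)),
    integral_const_mul, integral_gaussian, ← hA, add_div]
  have hs1 : (0 : ℝ) < √((m + 1 : ℕ) : ℝ) := by positivity
  refine add_le_add (le_of_eq ?_) ?_
  · rw [← Real.sqrt_div (by positivity)]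
    congr 1
    field_simp
  · rw [mul_div_right_comm]
    refine mul_le_mul_of_nonneg_right ?_ hA0
    rw [le_div_iff₀ hs1]
    refine le_trans ?_ (natCast_mul_pow_pred_le hq0 hq1 m)
    rw [mul_comm]
    refine mul_le_mul_of_nonneg_right ?_ (by positivity)
    have h1 : (1 : ℝ) ≤ ((m + 1 : ℕ) : ℝ) := by exact_mod_cast hn
    calc √((m + 1 : ℕ) : ℝ) ≤ ((m + 1 : ℕ) : ℝ) :=
        Real.sqrt_le_iff.2 ⟨by positivity, by nlinarith⟩
      _ = m + 1 := by push_cast; ring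

/-! ### Averaging operators -/

/-- The averaging operator `f ↦ J * f`. -/
noncomputable def avg (J f : ℝ → ℝ) (x : ℝ) : ℝ := ∫ y, J (x - y) * f y

/-- Averaging followed by killing inside the hole. -/
noncomputable def killedAvg (H : Set ℝ) (J f : ℝ → ℝ) : ℝ → ℝ := Hᶜ.indicator (avg J f)

lemma avg_eq_convolution (J f : ℝ → ℝ) :
    avg J f = (f ⋆[ContinuousLinearMap.mul ℝ ℝ, volume] J) := by
  ext x
  simp only [avg, MeasureTheory.convolution, ContinuousLinearMap.mul_apply']
  exact integral_congr_ae (Eventually.of_forall fun y => mul_comm _ _)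

/-- The equality holds at every point, since `f` enters only under the integral; thus averaging is
well defined on classes. -/
lemma avg_congr_ae {f g : ℝ → ℝ} (h : f =ᵐ[volume] g) : avg J f = avg J g := by
  ext x
  refine integral_congr_ae ?_
  filter_upwards [h] with y hy
  rw [hy]

lemma killedAvg_congr_ae {f g : ℝ → ℝ} (h : f =ᵐ[volume] g) : killedAvg H J f = killedAvg H J g := by
  rw [killedAvg, killedAvg, avg_congr_ae h]

lemma avg_nonneg (hJ : ∀ x, 0 ≤ J x) {f : ℝ → ℝ} (hf : ∀ᵐ x, 0 ≤ f x) (x : ℝ) : 0 ≤ avg J f x := by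
  refine integral_nonneg_of_ae ?_
  filter_upwards [hf] with y hy
  exact mul_nonneg (hJ _) hy

lemma IsKernel.exists_bound (hJ : IsKernel J) : ∃ K, ∀ x, ‖J x‖ ≤ K :=
  hJ.continuous.bounded_above_of_compact_support hJ.hasCompactSupport

lemma IsKernel.integrable_avg_integrand (hJ : IsKernel J) {f : ℝ → ℝ} (hf : Integrable f) (x : ℝ) :
    Integrable fun y => J (x - y) * f y := by
  obtain ⟨K, hK⟩ := hJ.exists_bound
  exact hf.bdd_mul (hJ.continuous.comp (by fun_prop)).aestronglyMeasurable
    (Eventually.of_forall fun y => hK _)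

lemma IsKernel.integrable_avg (hJ : IsKernel J) {f : ℝ → ℝ} (hf : Integrable f) :
    Integrable (avg J f) := by
  rw [avg_eq_convolution]
  exact hf.integrable_convolution _ hJ.integrable

lemma IsKernel.continuous_avg (hJ : IsKernel J) {f : ℝ → ℝ} (hf : Integrable f) :
    Continuous (avg J f) := by
  rw [avg_eq_convolution]
  exact hJ.hasCompactSupport.continuous_convolution_right _ hf.locallyIntegrable hJ.continuous

lemma IsKernel.avg_mono (hJ : IsKernel J) {f g : ℝ → ℝ} (hf : Integrable f) (hg : Integrable g)
    (h : f ≤ᵐ[volume] g) (x : ℝ) : avg J f x ≤ avg J g x := by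
  refine integral_mono_ae (hJ.integrable_avg_integrand hf x) (hJ.integrable_avg_integrand hg x) ?_
  filter_upwards [h] with y hy
  exact mul_le_mul_of_nonneg_left hy (hJ.nonneg _)

lemma IsKernel.integral_translate (hJ : IsKernel J) (x : ℝ) : ∫ y, J (x - y) = 1 := by
  rw [integral_sub_left_eq_self J volume x, hJ.integral_eq_one]

lemma IsKernel.avg_le_of_le (hJ : IsKernel J) {f : ℝ → ℝ} (hf : Integrable f) {K : ℝ}
    (h : ∀ᵐ x, f x ≤ K) (x : ℝ) : avg J f x ≤ K := by
  have hi : Integrable fun y => J (x - y) := hJ.integrable.comp_sub_left x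
  calc avg J f x ≤ ∫ y, J (x - y) * K := by
        refine integral_mono_ae (hJ.integrable_avg_integrand hf x) (hi.mul_const K) ?_
        filter_upwards [h] with y hy
        exact mul_le_mul_of_nonneg_left hy (hJ.nonneg _)
    _ = K := by rw [integral_mul_const, hJ.integral_translate, one_mul]

lemma IsKernel.integral_avg (hJ : IsKernel J) {f : ℝ → ℝ} (hf : Integrable f) :
    ∫ x, avg J f x = ∫ x, f x := by
  rw [avg_eq_convolution, integral_convolution _ hf hJ.integrable, hJ.integral_eq_one]
  simp

/-! ### Smoothing from `L¹` to `L^∞` -/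

lemma IsKernel.fourier_avg (hJ : IsKernel J) {f : ℝ → ℝ} (hf : Integrable f) (ξ : ℝ) :
    𝓕 (fun x => (avg J f x : ℂ)) ξ = kernelFourier J ξ * 𝓕 (fun x => (f x : ℂ)) ξ := by
  have h := Real.fourier_mul_convolution_eq (f₁ := fun x : ℝ => (f x : ℂ))
    (f₂ := fun x : ℝ => (J x : ℂ)) hf.ofReal hJ.integrable.ofReal ξ
  rw [kernelFourier, mul_comm, ← h]
  suffices e : (fun x => (avg J f x : ℂ)) = ((fun x : ℝ => (f x : ℂ)) ⋆[ContinuousLinearMap.mul ℂ ℂ,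
      volume] fun x : ℝ => (J x : ℂ)) by rw [e]
  ext x
  simp only [avg, MeasureTheory.convolution, ContinuousLinearMap.mul_apply']
  rw [← integral_complex_ofReal]
  exact integral_congr_ae (Eventually.of_forall fun y => by push_cast; ring)

lemma IsKernel.integrable_avg_iterate (hJ : IsKernel J) {f : ℝ → ℝ} (hf : Integrable f) (n : ℕ) :
    Integrable ((avg J)^[n] f) := by
  induction n with
  | zero => exact hf
  | succ n ih => rw [Function.iterate_succ_apply']; exact hJ.integrable_avg ih

lemma IsKernel.fourier_avg_iterate (hJ : IsKernel J) {f : ℝ → ℝ} (hf : Integrable f) (n : ℕ)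
    (ξ : ℝ) : 𝓕 (fun x => ((avg J)^[n] f x : ℂ)) ξ
      = kernelFourier J ξ ^ n * 𝓕 (fun x => (f x : ℂ)) ξ := by
  induction n with
  | zero => simp
  | succ n ih =>
    rw [Function.iterate_succ_apply', hJ.fourier_avg (hJ.integrable_avg_iterate hf n), ih]
    ring

/-- The smoothing estimate from `L¹` to `L^∞` for the iterated averages. -/
lemma IsKernel.exists_avg_iterate_le (hJ : IsKernel J) :
    ∃ C : ℝ, 0 < C ∧ ∀ f : ℝ → ℝ, Integrable f → ∀ n : ℕ, 1 ≤ n → ∀ x,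
      |(avg J)^[n] f x| ≤ C / √n * ∫ y, |f y| := by
  obtain ⟨C, hC, hpow⟩ := hJ.exists_integral_norm_kernelFourier_pow_le
  refine ⟨C, hC, fun f hf n hn x => ?_⟩
  obtain ⟨hpi, hple⟩ := hpow n hn
  set m := ∫ y, |f y| with hm
  have hm0 : 0 ≤ m := integral_nonneg fun _ => abs_nonneg _
  set g : ℝ → ℂ := fun x => ((avg J)^[n] f x : ℂ) with hg
  have hgi : Integrable g := (hJ.integrable_avg_iterate hf n).ofReal
  -- One averaging already makes the function continuous, which Fourier inversion at every point
  -- requires; hence `1 ≤ n`.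
  have hgc : Continuous g := by
    obtain ⟨k, rfl⟩ : ∃ k, n = k + 1 := ⟨n - 1, by omega⟩
    refine Complex.continuous_ofReal.comp ?_
    rw [Function.iterate_succ_apply']
    exact hJ.continuous_avg (hJ.integrable_avg_iterate hf k)
  have hb : ∀ ξ, ‖𝓕 g ξ‖ ≤ ‖kernelFourier J ξ‖ ^ n * m := by
    intro ξ
    rw [hJ.fourier_avg_iterate hf, norm_mul, norm_pow]
    gcongr
    refine (norm_fourier_le _ ξ).trans_eq ?_
    simp [hm]
  have hFc : Continuous (𝓕 g) :=
    VectorFourier.fourierIntegral_continuous continuous_fourierChar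
      (L := innerₗ ℝ) continuous_inner hgi
  have hFi : Integrable (𝓕 g) :=
    (hpi.mul_const m).mono' hFc.aestronglyMeasurable (Eventually.of_forall hb)
  have hinv := hgi.fourierInv_fourier_eq hFi (v := x) hgc.continuousAt
  have h1 : ‖g x‖ ≤ ∫ ξ, ‖𝓕 g ξ‖ := by
    rw [← hinv, Real.fourierInv_eq_fourier_neg]
    exact norm_fourier_le _ _
  have h2 : ‖g x‖ = |(avg J)^[n] f x| := by simp [hg]
  rw [← h2]
  calc ‖g x‖ ≤ ∫ ξ, ‖𝓕 g ξ‖ := h1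
    _ ≤ ∫ ξ, ‖kernelFourier J ξ‖ ^ n * m := integral_mono hFi.norm (hpi.mul_const m) hb
    _ = (∫ ξ, ‖kernelFourier J ξ‖ ^ n) * m := integral_mul_const _ _
    _ ≤ C / √n * m := by gcongr

/-! ### Averaging in the weighted space -/

lemma integrable_of_integrable_mul_one_add_sq {f : ℝ → ℝ}
    (hf : Integrable fun x => f x * (1 + x ^ 2)) : Integrable f := by
  have hm : AEStronglyMeasurable f volume := by
    have h := hf.aestronglyMeasurable.mul
      (Continuous.aestronglyMeasurable (f := fun x : ℝ => (1 + x ^ 2)⁻¹)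
        (Continuous.inv₀ (by fun_prop) fun x => by positivity))
    refine h.congr (Eventually.of_forall fun x => ?_)
    have : (1 + x ^ 2) ≠ 0 := by positivity
    simp only [Pi.mul_apply]
    field_simp
  refine hf.mono hm (Eventually.of_forall fun x => ?_)
  rw [norm_mul, Real.norm_of_nonneg (by positivity : (0 : ℝ) ≤ 1 + x ^ 2)]
  exact le_mul_of_one_le_right (norm_nonneg _) (by nlinarith [sq_nonneg x])

/-- Submultiplicativity of the weight up to the factor 2: it makes convolution with a kernel of
finite second moment bounded on the weighted space. -/
lemma one_add_sq_le (x y : ℝ) : 1 + x ^ 2 ≤ 2 * ((1 + (x - y) ^ 2) * (1 + y ^ 2)) := by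
  nlinarith [sq_nonneg (x - y - y), sq_nonneg ((x - y) * y)]

/-- The Fubini hypothesis behind the symmetry of averaging, for test functions of quadratic growth.
By `one_add_sq_le` the integrand is dominated by the convolution integrand of `f` and `J`, both
weighted. -/
lemma IsKernel.integrable_prod (hJ : IsKernel J) {f w : ℝ → ℝ} {A : ℝ}
    (hf : Integrable fun x => f x * (1 + x ^ 2)) (hw : AEStronglyMeasurable w volume)
    (hA : ∀ x, |w x| ≤ A * (1 + x ^ 2)) :
    Integrable (fun p : ℝ × ℝ => w p.1 * (J (p.1 - p.2) * f p.2)) (volume.prod volume) := by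
  have hJ2 : Integrable fun z => J z * (1 + z ^ 2) := hJ.integrable_mul (by fun_prop)
  have h1 := (hf.convolution_integrand (ContinuousLinearMap.mul ℝ ℝ) hJ2).const_mul (2 * A)
  have h2 := (integrable_of_integrable_mul_one_add_sq hf).convolution_integrand
    (ContinuousLinearMap.mul ℝ ℝ) hJ.integrable
  simp only [ContinuousLinearMap.mul_apply'] at h1 h2
  have hm : AEStronglyMeasurable (fun p : ℝ × ℝ => w p.1 * (J (p.1 - p.2) * f p.2))
      (volume.prod volume) := by
    refine hw.comp_fst.mul (h2.aestronglyMeasurable.congr (Eventually.of_forall fun p => ?_))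
    exact mul_comm _ _
  refine h1.mono hm (Eventually.of_forall fun p => ?_)
  have hA0 : 0 ≤ A := by
    have := (abs_nonneg _).trans (hA 0)
    simpa using this
  simp only [norm_mul, Real.norm_eq_abs]
  rw [abs_of_nonneg hA0, abs_of_nonneg (hJ.nonneg (p.1 - p.2)),
    abs_of_nonneg (by positivity : (0 : ℝ) ≤ 1 + p.2 ^ 2),
    abs_of_nonneg (by positivity : (0 : ℝ) ≤ 1 + (p.1 - p.2) ^ 2), abs_two]
  have h3 : |w p.1| ≤ A * (2 * ((1 + (p.1 - p.2) ^ 2) * (1 + p.2 ^ 2))) :=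
    (hA p.1).trans (mul_le_mul_of_nonneg_left (one_add_sq_le _ _) hA0)
  calc |w p.1| * (J (p.1 - p.2) * |f p.2|)
      ≤ A * (2 * ((1 + (p.1 - p.2) ^ 2) * (1 + p.2 ^ 2))) * (J (p.1 - p.2) * |f p.2|) :=
        mul_le_mul_of_nonneg_right h3 (mul_nonneg (hJ.nonneg _) (abs_nonneg _))
    _ = _ := by ring

lemma IsKernel.integrable_mul_avg (hJ : IsKernel J) {f w : ℝ → ℝ} {A : ℝ}
    (hf : Integrable fun x => f x * (1 + x ^ 2)) (hw : AEStronglyMeasurable w volume)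
    (hA : ∀ x, |w x| ≤ A * (1 + x ^ 2)) : Integrable fun x => w x * avg J f x := by
  have h := (hJ.integrable_prod hf hw hA).integral_prod_left
  simp only [integral_const_mul] at h
  exact h

/-- The averaging operator is symmetric. -/
lemma IsKernel.integral_mul_avg (hJ : IsKernel J) {f w : ℝ → ℝ} {A : ℝ}
    (hf : Integrable fun x => f x * (1 + x ^ 2)) (hw : AEStronglyMeasurable w volume)
    (hA : ∀ x, |w x| ≤ A * (1 + x ^ 2)) :
    ∫ x, w x * avg J f x = ∫ y, f y * avg J w y := by
  have h := integral_integral_swap (f := fun x y => w x * (J (x - y) * f y))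
    (hJ.integrable_prod hf hw hA)
  simp only [integral_const_mul] at h
  refine h.trans (integral_congr_ae (Eventually.of_forall fun y => ?_))
  simp only [avg]
  rw [← integral_const_mul]
  refine integral_congr_ae (Eventually.of_forall fun x => ?_)
  simp only
  rw [← hJ.even (x - y), neg_sub]
  ring

lemma IsKernel.integrable_avg_moment (hJ : IsKernel J) {f : ℝ → ℝ}
    (hf : Integrable fun x => f x * (1 + x ^ 2)) :
    Integrable fun x => avg J f x * (1 + x ^ 2) := by
  have h := hJ.integrable_mul_avg (w := fun x => 1 + x ^ 2) (A := 1) hf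
    (by fun_prop) (fun x => by rw [one_mul, abs_of_nonneg (by positivity)])
  simpa only [mul_comm] using h

/-- The averaging operator is bounded on the weighted space. -/
lemma IsKernel.integral_abs_avg_moment_le (hJ : IsKernel J) {f : ℝ → ℝ}
    (hf : Integrable fun x => f x * (1 + x ^ 2)) :
    ∫ x, |avg J f x| * (1 + x ^ 2)
      ≤ 2 * (∫ z, J z * (1 + z ^ 2)) * ∫ x, |f x| * (1 + x ^ 2) := by
  have hJ2 : Integrable fun z => J z * (1 + z ^ 2) := hJ.integrable_mul (by fun_prop)
  have hfa : Integrable fun x => |f x| * (1 + x ^ 2) := by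
    refine hf.abs.congr (Eventually.of_forall fun x => ?_)
    simp only [abs_mul]
    rw [abs_of_nonneg (by positivity : (0 : ℝ) ≤ 1 + x ^ 2)]
  have hf1 := integrable_of_integrable_mul_one_add_sq hf
  have hconv := hfa.integrable_convolution (ContinuousLinearMap.mul ℝ ℝ) hJ2
  have hex := hfa.ae_convolution_exists (ContinuousLinearMap.mul ℝ ℝ) hJ2
  have hle : ∀ᵐ x, |avg J f x| * (1 + x ^ 2)
      ≤ 2 * ((fun x => |f x| * (1 + x ^ 2)) ⋆[ContinuousLinearMap.mul ℝ ℝ, volume]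
        fun z => J z * (1 + z ^ 2)) x := by
    filter_upwards [hex] with x hx
    have hi := hJ.integrable_avg_integrand hf1.abs x
    calc |avg J f x| * (1 + x ^ 2) ≤ (∫ y, J (x - y) * |f y|) * (1 + x ^ 2) := by
          gcongr
          refine (abs_integral_le_integral_abs).trans_eq ?_
          simp_rw [abs_mul, abs_of_nonneg (hJ.nonneg _)]
      _ = ∫ y, J (x - y) * |f y| * (1 + x ^ 2) := (integral_mul_const _ _).symm
      _ ≤ ∫ y, 2 * ((|f y| * (1 + y ^ 2)) * (J (x - y) * (1 + (x - y) ^ 2))) := by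
          refine integral_mono (hi.mul_const _) (hx.integrable.const_mul 2) fun y => ?_
          have := mul_le_mul_of_nonneg_left (one_add_sq_le x y)
            (mul_nonneg (hJ.nonneg (x - y)) (abs_nonneg (f y)))
          simp only
          linarith
      _ = _ := integral_const_mul _ _
  have hlhs : Integrable fun x => |avg J f x| * (1 + x ^ 2) := by
    refine (hJ.integrable_avg_moment hf).abs.congr (Eventually.of_forall fun x => ?_)
    simp only [abs_mul]
    rw [abs_of_nonneg (by positivity : (0 : ℝ) ≤ 1 + x ^ 2)]
  refine (integral_mono_ae hlhs (hconv.const_mul 2) hle).trans_eq ?_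
  rw [integral_const_mul, integral_convolution _ hfa hJ2, ContinuousLinearMap.mul_apply']
  ring

/-! ### A superharmonic function outside the hole -/

lemma IsKernel.apply_abs (hJ : IsKernel J) (x : ℝ) : J |x| = J x := by
  rcases abs_choice x with h | h <;> rw [h]
  exact hJ.even x

/-- From points within the range of the kernel, the jump into `(-a₀, a₀)` has probability bounded
below. -/
lemma IsKernel.exists_le_integral_hit (hJ : IsKernel J) {d a₀ : ℝ} (hd : 0 < d)
    (hs : Function.support J = Ioo (-d) d) (ha : 0 < a₀) :
    ∃ p : ℝ, 0 < p ∧ ∀ y, |y| ≤ d → p ≤ ∫ x in Ioo (-a₀) a₀, J (y - x) := by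
  set r := min a₀ d with hr
  have hr0 : 0 < r := lt_min ha hd
  have hra : r ≤ a₀ := min_le_left _ _
  have hrd : r ≤ d := min_le_right _ _
  have hj : 0 < J (d - r / 3) := by
    refine lt_of_le_of_ne (hJ.nonneg _) (Ne.symm ?_)
    have : d - r / 3 ∈ Function.support J := by rw [hs]; constructor <;> linarith
    exact this
  have hlow : ∀ t, |t| ≤ d - r / 3 → J (d - r / 3) ≤ J t := by
    intro t ht
    rw [← hJ.apply_abs t]
    exact hJ.antitoneOn (abs_nonneg t) (by rw [mem_Ici]; linarith) ht
  have key : ∀ y u : ℝ, Ioo u (u + r / 3) ⊆ Ioo (-a₀) a₀ →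
      (∀ x ∈ Ioo u (u + r / 3), |y - x| ≤ d - r / 3) →
      J (d - r / 3) * (r / 3) ≤ ∫ x in Ioo (-a₀) a₀, J (y - x) := by
    intro y u hsub hdist
    have hi : Integrable fun x => J (y - x) := hJ.integrable.comp_sub_left y
    calc J (d - r / 3) * (r / 3) = ∫ x in Ioo u (u + r / 3), J (d - r / 3) := by
          rw [setIntegral_const, Measure.real, Real.volume_Ioo,
            ENNReal.toReal_ofReal (by linarith), smul_eq_mul]
          ring
      _ ≤ ∫ x in Ioo u (u + r / 3), J (y - x) :=
          setIntegral_mono_on (by simp) hi.integrableOn measurableSet_Ioo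
            fun x hx => hlow _ (hdist x hx)
      _ ≤ ∫ x in Ioo (-a₀) a₀, J (y - x) :=
          setIntegral_mono_set hi.integrableOn (Eventually.of_forall fun x => hJ.nonneg _)
            (Eventually.of_forall hsub)
  refine ⟨J (d - r / 3) * (r / 3), by positivity, fun y hy => ?_⟩
  rw [abs_le] at hy
  -- At `|y| = d` jumps are possible only towards the origin, so the target window is the middle
  -- third of `(0, r)` or `(-r, 0)`, on the side of `y`. All its points are within `d - r / 3` of
  -- `y`, where monotonicity keeps `J` above a positive constant.
  rcases le_total 0 y with h0 | h0
  · refine key y (r / 3) (fun x hx => ?_) fun x hx => ?_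
    · constructor <;> linarith [hx.1, hx.2]
    · rw [abs_le]; constructor <;> linarith [hx.1, hx.2]
  · refine key y (-(2 * r / 3)) (fun x hx => ?_) fun x hx => ?_
    · constructor <;> linarith [hx.1, hx.2]
    · rw [abs_le]; constructor <;> linarith [hx.1, hx.2]

lemma avg_abs_eq (J : ℝ → ℝ) (y : ℝ) :
    avg J (fun x => |x|) y = ∫ z, J z * |y - z| := by
  have h := integral_sub_left_eq_self (fun z => J z * |y - z|) volume y
  simp only [sub_sub_cancel] at h
  exact h

/-- For `|y| ≥ d` the sign of `y - z` is constant on the support of `J`, so `|y - z|` is affine in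
`z` there and its odd part integrates to zero. -/
lemma IsKernel.avg_abs_of_le (hJ : IsKernel J) {d : ℝ}
    (hs : Function.support J = Ioo (-d) d) {y : ℝ} (hy : d ≤ |y|) :
    avg J (fun x => |x|) y = |y| := by
  have hmem : ∀ z, J z ≠ 0 → -d < z ∧ z < d := by
    intro z hz
    have : z ∈ Function.support J := hz
    rwa [hs] at this
  have h0 : ∫ z, J z * z = 0 := hJ.integral_mul_odd fun _ => rfl
  have hi : Integrable fun z => J z * z := hJ.integrable_mul continuous_id
  rw [avg_abs_eq]
  rcases le_total 0 y with h | h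
  · rw [abs_of_nonneg h] at hy ⊢
    have e : ∀ z, J z * |y - z| = J z * y - J z * z := by
      intro z
      by_cases hz : J z = 0
      · simp [hz]
      · rw [abs_of_nonneg (by linarith [(hmem z hz).2])]; ring
    simp_rw [e]
    rw [integral_sub (hJ.integrable.mul_const y) hi, h0, integral_mul_const, hJ.integral_eq_one]
    ring
  · rw [abs_of_nonpos h] at hy ⊢
    have e : ∀ z, J z * |y - z| = J z * z - J z * y := by
      intro z
      by_cases hz : J z = 0
      · simp [hz]
      · rw [abs_of_nonpos (by linarith [(hmem z hz).1])]; ring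
    simp_rw [e]
    rw [integral_sub hi (hJ.integrable.mul_const y), h0, integral_mul_const, hJ.integral_eq_one]
    ring

lemma IsKernel.avg_abs_le (hJ : IsKernel J) {d : ℝ}
    (hs : Function.support J = Ioo (-d) d) (y : ℝ) :
    avg J (fun x => |x|) y ≤ |y| + d := by
  rw [avg_abs_eq]
  calc ∫ z, J z * |y - z| ≤ ∫ z, J z * (|y| + d) := by
        refine integral_mono (hJ.integrable_mul (by fun_prop)) (hJ.integrable.mul_const _)
          fun z => ?_
        by_cases hz : J z = 0
        · simp [hz]
        · have : z ∈ Function.support J := hz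
          rw [hs] at this
          have hz' : |z| ≤ d := abs_le.2 ⟨this.1.le, this.2.le⟩
          exact mul_le_mul_of_nonneg_left ((abs_sub y z).trans (by linarith)) (hJ.nonneg z)
    _ = |y| + d := by rw [integral_mul_const, hJ.integral_eq_one, one_mul]

/-- The function `(|x| + B) 1_{ℝ \ H}` is superharmonic outside the hole when `B` is large. -/
lemma IsKernel.exists_superharmonic (hJ : IsKernel J) (hH : IsHole H) :
    ∃ B : ℝ, 0 ≤ B ∧ ∀ y, avg J (Hᶜ.indicator fun x => |x| + B) y ≤ |y| + B := by
  obtain ⟨a₀, a, ha₀, -, hsub, -⟩ := hH.bounds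
  obtain ⟨d, hd, hs⟩ := hJ.support_eq
  obtain ⟨p, hp, hhit⟩ := hJ.exists_le_integral_hit hd hs ha₀
  -- Averaging raises `|x|` only for `|y| < d`, and by at most `d`. For such `y` a jump into `(-a₀,
  -- a₀)` has probability at least `p` and forfeits at least `B`; the choice `B p = d` balances the
  -- two.
  refine ⟨d / p, by positivity, fun y => ?_⟩
  set B := d / p with hB
  have hB0 : 0 ≤ B := by positivity
  have hcomp : HasCompactSupport fun x => J (y - x) :=
    hJ.hasCompactSupport.comp_homeomorph (Homeomorph.subLeft y)
  have hcont : Continuous fun x => J (y - x) := hJ.continuous.comp (by fun_prop)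
  have hi1 : Integrable fun x => J (y - x) := hJ.integrable.comp_sub_left y
  have hiabs : Integrable fun x => J (y - x) * |x| :=
    (hcont.mul continuous_abs).integrable_of_hasCompactSupport hcomp.mul_right
  have hiS : Integrable ((Ioo (-a₀) a₀).indicator fun x => J (y - x)) :=
    hi1.indicator measurableSet_Ioo
  have hphi : Integrable fun x => J (y - x) * Hᶜ.indicator (fun x => |x| + B) x := by
    have := (hiabs.add (hi1.mul_const B)).indicator hH.isOpen.measurableSet.compl
    refine this.congr (Eventually.of_forall fun x => ?_)
    by_cases hx : x ∈ Hᶜ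
    · simp only [indicator_of_mem hx, Pi.add_apply]; ring
    · simp only [indicator_of_notMem hx, mul_zero]
  have hle : avg J (Hᶜ.indicator fun x => |x| + B) y
      ≤ avg J (fun x => |x|) y + B - B * ∫ x in Ioo (-a₀) a₀, J (y - x) := by
    calc avg J (Hᶜ.indicator fun x => |x| + B) y
        ≤ ∫ x, (J (y - x) * |x| + J (y - x) * B
            - B * (Ioo (-a₀) a₀).indicator (fun x => J (y - x)) x) := by
          refine integral_mono hphi ((hiabs.add (hi1.mul_const B)).sub (hiS.const_mul B))
            fun x => ?_
          have h1 : 0 ≤ J (y - x) * |x| := mul_nonneg (hJ.nonneg _) (abs_nonneg _)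
          have h2 : 0 ≤ J (y - x) * B := mul_nonneg (hJ.nonneg _) hB0
          by_cases hx : x ∈ Ioo (-a₀) a₀
          · have hx' : x ∉ Hᶜ := fun h => h (hsub hx)
            simp only [indicator_of_mem hx, indicator_of_notMem hx']
            linarith
          · simp only [indicator_of_notMem hx]
            by_cases hx' : x ∈ Hᶜ
            · simp only [indicator_of_mem hx']; linarith
            · simp only [indicator_of_notMem hx']; linarith
      _ = _ := by
          rw [integral_sub, integral_add hiabs (hi1.mul_const B), integral_mul_const,
            hJ.integral_translate, integral_const_mul, integral_indicator measurableSet_Ioo, avg,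
            one_mul]
          exacts [hiabs.add (hi1.mul_const B), hiS.const_mul B]
  refine hle.trans ?_
  rcases le_total d |y| with h | h
  · rw [hJ.avg_abs_of_le hs h]
    have : 0 ≤ ∫ x in Ioo (-a₀) a₀, J (y - x) := integral_nonneg fun x => hJ.nonneg _
    nlinarith
  · have h1 := hJ.avg_abs_le hs y
    have h2 := mul_le_mul_of_nonneg_left (hhit y h) hB0
    have h3 : B * p = d := by rw [hB]; field_simp
    linarith

/-! ### Mass and first moment under killed averaging -/

lemma IsKernel.integrable_killedAvg_moment (hJ : IsKernel J) (hH : IsHole H) {f : ℝ → ℝ}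
    (hf : Integrable fun x => f x * (1 + x ^ 2)) :
    Integrable fun x => killedAvg H J f x * (1 + x ^ 2) := by
  refine ((hJ.integrable_avg_moment hf).indicator
    hH.isOpen.measurableSet.compl).congr (Eventually.of_forall fun x => ?_)
  simp only [killedAvg]
  by_cases hx : x ∈ Hᶜ
  · simp only [indicator_of_mem hx]
  · simp only [indicator_of_notMem hx, zero_mul]

/-- Nonnegative functions vanishing in the hole with finite second moment. -/
structure IsAdmissible (H : Set ℝ) (f : ℝ → ℝ) : Prop where
  nonneg : ∀ᵐ x, 0 ≤ f x
  eq_zero : ∀ᵐ x, x ∈ H → f x = 0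
  moment : Integrable fun x => f x * (1 + x ^ 2)

lemma IsAdmissible.integrable {f : ℝ → ℝ} (hf : IsAdmissible H f) : Integrable f :=
  integrable_of_integrable_mul_one_add_sq hf.moment

lemma IsAdmissible.integrable_mul_abs_add {f : ℝ → ℝ} (hf : IsAdmissible H f) (B : ℝ) :
    Integrable fun x => f x * (|x| + B) := by
  have h : Integrable fun x => f x * |x| := by
    refine hf.moment.mono (hf.integrable.aestronglyMeasurable.mul
      continuous_abs.aestronglyMeasurable) (Eventually.of_forall fun x => ?_)
    rw [norm_mul, norm_mul]
    gcongr
    rw [Real.norm_of_nonneg (abs_nonneg _), Real.norm_of_nonneg (by positivity)]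
    nlinarith [sq_abs x, sq_nonneg (|x| - 1)]
  simp only [mul_add]
  exact h.add (hf.integrable.mul_const B)

lemma IsKernel.isAdmissible_killedAvg (hJ : IsKernel J) (hH : IsHole H) {f : ℝ → ℝ}
    (hf : IsAdmissible H f) : IsAdmissible H (killedAvg H J f) where
  nonneg := Eventually.of_forall
    (indicator_nonneg fun x _ => avg_nonneg hJ.nonneg hf.nonneg x)
  eq_zero := Eventually.of_forall fun _ hx => indicator_of_notMem (notMem_compl_iff.2 hx) _
  moment := hJ.integrable_killedAvg_moment hH hf.moment

lemma IsKernel.isAdmissible_killedAvg_iterate (hJ : IsKernel J) (hH : IsHole H) {f : ℝ → ℝ}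
    (hf : IsAdmissible H f) (n : ℕ) : IsAdmissible H ((killedAvg H J)^[n] f) := by
  induction n with
  | zero => exact hf
  | succ n ih => rw [Function.iterate_succ_apply']; exact hJ.isAdmissible_killedAvg hH ih

lemma IsKernel.killedAvg_le_avg (hJ : IsKernel J) {f : ℝ → ℝ} (hf : ∀ᵐ x, 0 ≤ f x) (x : ℝ) :
    killedAvg H J f x ≤ avg J f x :=
  indicator_le_self' (fun y _ => avg_nonneg hJ.nonneg hf y) x

/-- Killing only decreases and averaging is monotone; this transfers the free smoothing estimate to
the killed iterates. -/
lemma IsKernel.killedAvg_iterate_le (hJ : IsKernel J) (hH : IsHole H) {f : ℝ → ℝ}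
    (hf : IsAdmissible H f) (n : ℕ) (x : ℝ) : (killedAvg H J)^[n] f x ≤ (avg J)^[n] f x := by
  induction n generalizing x with
  | zero => exact le_rfl
  | succ n ih =>
    have ha := hJ.isAdmissible_killedAvg_iterate hH hf n
    rw [Function.iterate_succ_apply', Function.iterate_succ_apply']
    exact (hJ.killedAvg_le_avg ha.nonneg x).trans
      (hJ.avg_mono ha.integrable (hJ.integrable_avg_iterate hf.integrable n)
        (Eventually.of_forall ih) x)

lemma IsKernel.integral_killedAvg_le (hJ : IsKernel J) (hH : IsHole H) {f : ℝ → ℝ}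
    (hf : IsAdmissible H f) : ∫ x, killedAvg H J f x ≤ ∫ x, f x := by
  rw [← hJ.integral_avg hf.integrable]
  exact integral_mono (hJ.isAdmissible_killedAvg hH hf).integrable (hJ.integrable_avg hf.integrable)
    (hJ.killedAvg_le_avg hf.nonneg)

/-- By duality: the cut-off is moved to the weight, symmetry moves the average onto the cut-off
weight, and superharmonicity bounds the result. -/
lemma IsKernel.integral_killedAvg_mul_le (hJ : IsKernel J) (hH : IsHole H) {B : ℝ} (hB : 0 ≤ B)
    (hsup : ∀ y, avg J (Hᶜ.indicator fun x => |x| + B) y ≤ |y| + B) {f : ℝ → ℝ}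
    (hf : IsAdmissible H f) :
    ∫ x, killedAvg H J f x * (|x| + B) ≤ ∫ x, f x * (|x| + B) := by
  set w : ℝ → ℝ := Hᶜ.indicator fun x => |x| + B with hw
  have hwm : AEStronglyMeasurable w volume :=
    (Continuous.aestronglyMeasurable (by fun_prop)).indicator hH.isOpen.measurableSet.compl
  have hw0 : ∀ x, 0 ≤ w x := indicator_nonneg fun x _ => by positivity
  have hwA : ∀ x, |w x| ≤ (1 + B) * (1 + x ^ 2) := by
    intro x
    rw [abs_of_nonneg (hw0 x)]
    refine (indicator_le_self' (fun x _ => by positivity) x).trans ?_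
    nlinarith [sq_abs x, sq_nonneg (|x| - 1), mul_nonneg hB (sq_nonneg x)]
  have e : ∀ x, killedAvg H J f x * (|x| + B) = w x * avg J f x := by
    intro x
    by_cases hx : x ∈ Hᶜ
    · simp only [killedAvg, hw, indicator_of_mem hx, mul_comm]
    · simp only [killedAvg, hw, indicator_of_notMem hx, zero_mul]
  simp_rw [e]
  rw [hJ.integral_mul_avg hf.moment hwm hwA]
  refine integral_mono_of_nonneg ?_ (hf.integrable_mul_abs_add B) ?_
  · filter_upwards [hf.nonneg] with y hy
    exact mul_nonneg hy (avg_nonneg hJ.nonneg (Eventually.of_forall hw0) y)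
  · filter_upwards [hf.nonneg] with y hy
    exact mul_le_mul_of_nonneg_left (hsup y) hy

/-! ### Decay of the killed iterates -/

/-- A mass that is spread out and has a bounded first moment is small. -/
lemma IsAdmissible.integral_le {f : ℝ → ℝ} (hf : IsAdmissible H f) {S B R : ℝ}
    (hB : 0 ≤ B) (hR : 0 < R) (hfS : ∀ᵐ x, f x ≤ S) :
    ∫ x, f x ≤ 2 * R * S + (∫ x, f x * (|x| + B)) / R := by
  have hi1 : Integrable ((Icc (-R) R).indicator fun _ : ℝ => S) :=
    (integrableOn_const (by simp)).integrable_indicator measurableSet_Icc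
  have hi2 := (hf.integrable_mul_abs_add B).div_const R
  calc ∫ x, f x ≤ ∫ x, ((Icc (-R) R).indicator (fun _ : ℝ => S) x + f x * (|x| + B) / R) := by
        refine integral_mono_ae hf.integrable (hi1.add hi2) ?_
        filter_upwards [hf.nonneg, hfS] with x h0 h1
        by_cases hx : x ∈ Icc (-R) R
        · simp only [indicator_of_mem hx]
          have : 0 ≤ f x * (|x| + B) / R := by positivity
          linarith
        · simp only [indicator_of_notMem hx, zero_add]
          have hx' : R ≤ |x| := by
            by_contra h
            exact hx (abs_le.1 (not_le.1 h).le)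
          rw [le_div_iff₀ hR]
          exact mul_le_mul_of_nonneg_left (by linarith) h0
    _ = _ := by
        rw [integral_add hi1 hi2, integral_indicator measurableSet_Icc, setIntegral_const,
          integral_div, Measure.real, Real.volume_Icc, ENNReal.toReal_ofReal (by linarith),
          smul_eq_mul]
        ring

/-- A nonincreasing sequence satisfying a mass-spreading inequality is `O(n ^ (-1/2))`. -/
lemma exists_le_div_sqrt {m : ℕ → ℝ} (hm : Antitone m) (hm0 : ∀ n, 0 ≤ m n) {C M : ℝ} (hC : 0 < C)
    (hM : 0 ≤ M)
    (h : ∀ k l : ℕ, 1 ≤ l → ∀ R : ℝ, 0 < R → m (k + l) ≤ 2 * R * (C / √l * m k) + M / R) :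
    ∃ D : ℝ, 0 ≤ D ∧ ∀ n : ℕ, 1 ≤ n → m n ≤ D / √n := by
  -- `m 1` serves the base case. In the doubling step `8CM ≤ D / 4` leaves `D / (2√k)`, which is at
  -- most `D / √n` because `n ≤ 4k`.
  set D := max (32 * C * M) (m 1) with hD
  have hD0 : 0 ≤ D := (hm0 1).trans (le_max_right _ _)
  refine ⟨D, hD0, fun n => ?_⟩
  induction n using Nat.strong_induction_on with
  | _ n ih =>
  intro hn
  rcases Nat.lt_or_ge n 2 with h2 | h2
  · obtain rfl : n = 1 := by omega
    rw [Nat.cast_one, Real.sqrt_one, div_one]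
    exact le_max_right _ _
  · obtain ⟨k, hk1, hk2, hk3⟩ : ∃ k : ℕ, 1 ≤ k ∧ 2 * k ≤ n ∧ n ≤ 4 * k := ⟨n / 2, by omega⟩
    have hk0 : (0 : ℝ) < k := by exact_mod_cast hk1
    have hsk : 0 < √(k : ℝ) := Real.sqrt_pos.2 hk0
    have hih := ih k (by omega) hk1
    -- This radius turns the coefficient of `m k` into `1/4`, a gain that survives the loss of a
    -- factor 2 in passing from `√k` to `√n`.
    have hstep := h k k hk1 (√k / (8 * C)) (by positivity)
    have e1 : 2 * (√k / (8 * C)) * (C / √k * m k) = m k / 4 := by field_simp; ring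
    have e2 : M / (√k / (8 * C)) = 8 * C * M / √k := by field_simp
    rw [e1, e2] at hstep
    have hDM : 8 * C * M ≤ D / 4 := by
      have := le_max_left (32 * C * M) (m 1)
      linarith
    have hnk : √(n : ℝ) ≤ 2 * √k := by
      refine Real.sqrt_le_iff.2 ⟨by positivity, ?_⟩
      rw [mul_pow, Real.sq_sqrt hk0.le]
      have : (n : ℝ) ≤ 4 * k := by exact_mod_cast hk3
      linarith
    have hsn : 0 < √(n : ℝ) := Real.sqrt_pos.2 (by exact_mod_cast hn)
    calc m n ≤ m (k + k) := hm (by omega)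
      _ ≤ m k / 4 + 8 * C * M / √k := hstep
      _ ≤ D / √k / 4 + D / 4 / √k := by gcongr
      _ = D / (2 * √k) := by field_simp; ring
      _ ≤ D / √n := by gcongr

/-- The iterates of the killed averaging operator decay uniformly like `1 / n`. -/
lemma IsKernel.exists_killedAvg_iterate_le (hJ : IsKernel J) (hH : IsHole H) {f : ℝ → ℝ}
    (hf : IsAdmissible H f) {K : ℝ} (hK : ∀ᵐ x, f x ≤ K) :
    ∃ C : ℝ, 0 ≤ C ∧ ∀ n : ℕ, ∀ᵐ x, (killedAvg H J)^[n] f x ≤ C / (n + 1) := by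
  obtain ⟨C, hC, hsmooth⟩ := hJ.exists_avg_iterate_le
  obtain ⟨B, hB, hsup⟩ := hJ.exists_superharmonic hH
  have hadm := hJ.isAdmissible_killedAvg_iterate hH hf
  set m : ℕ → ℝ := fun n => ∫ x, (killedAvg H J)^[n] f x with hm
  have hm0 : ∀ n, 0 ≤ m n := fun n => integral_nonneg_of_ae (hadm n).nonneg
  have hanti : Antitone m := antitone_nat_of_succ_le fun n => by
    simp only [hm, Function.iterate_succ_apply']
    exact hJ.integral_killedAvg_le hH (hadm n)
  set M := ∫ x, f x * (|x| + B) with hM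
  have hM0 : 0 ≤ M := by
    refine integral_nonneg_of_ae ?_
    filter_upwards [hf.nonneg] with x hx
    positivity
  have hMn : ∀ n, ∫ x, (killedAvg H J)^[n] f x * (|x| + B) ≤ M := by
    intro n
    induction n with
    | zero => exact le_rfl
    | succ n ih =>
      simp only [Function.iterate_succ_apply']
      exact (hJ.integral_killedAvg_mul_le hH hB hsup (hadm n)).trans ih
  -- The first `k` steps keep their killing, which reduces the mass; the last `l` are compared with
  -- free averaging, which spreads it.
  have hspread : ∀ k l : ℕ, 1 ≤ l → ∀ x, (killedAvg H J)^[k + l] f x ≤ C / √l * m k := by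
    intro k l hl x
    have e : ∫ y, |(killedAvg H J)^[k] f y| = m k := by
      refine integral_congr_ae ?_
      filter_upwards [(hadm k).nonneg] with y hy
      exact abs_of_nonneg hy
    rw [← e, add_comm k l, Function.iterate_add_apply]
    exact (hJ.killedAvg_iterate_le hH (hadm k) l x).trans
      ((le_abs_self _).trans (hsmooth _ (hadm k).integrable l hl x))
  obtain ⟨D, hD0, hD⟩ := exists_le_div_sqrt hanti hm0 hC hM0 fun k l hl R hR => by
    refine ((hadm (k + l)).integral_le (S := C / √l * m k) hB hR
      (Eventually.of_forall (hspread k l hl))).trans ?_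
    gcongr
    exact hMn _
  have hK0 : 0 ≤ |K| := abs_nonneg K
  have hfK : ∀ᵐ x, f x ≤ |K| := hK.mono fun x hx => hx.trans (le_abs_self K)
  -- For `n ≤ 1` the initial bound suffices, with `n + 1 ≤ 2`. For `n ≥ 2` mass decay and spreading
  -- over the two halves give `CD / k`, with `n + 1 ≤ 6k`.
  refine ⟨2 * |K| + 6 * (C * D), by positivity, fun n => ?_⟩
  rcases Nat.lt_or_ge n 2 with h2 | h2
  · have hle : ∀ᵐ x, (killedAvg H J)^[n] f x ≤ |K| := by
      obtain rfl | rfl : n = 0 ∨ n = 1 := by omega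
      · exact hfK
      · exact Eventually.of_forall fun x => (hJ.killedAvg_le_avg hf.nonneg x).trans
          (hJ.avg_le_of_le hf.integrable hfK x)
    filter_upwards [hle] with x hx
    refine hx.trans ?_
    rw [le_div_iff₀ (by positivity)]
    have : (n : ℝ) ≤ 1 := by exact_mod_cast (by omega : n ≤ 1)
    have : 0 ≤ C * D := by positivity
    nlinarith
  · obtain ⟨k, l, hk, hl, hkl, hln⟩ : ∃ k l : ℕ, 1 ≤ k ∧ n + 1 ≤ 6 * k ∧ k + l = n ∧ k ≤ l :=
      ⟨n / 2, n - n / 2, by omega⟩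
    refine Eventually.of_forall fun x => ?_
    have hk0 : (0 : ℝ) < k := by exact_mod_cast hk
    rw [← hkl]
    have hsk : 0 < √(k : ℝ) := Real.sqrt_pos.2 hk0
    have hskl : √(k : ℝ) ≤ √l := Real.sqrt_le_sqrt (by exact_mod_cast hln)
    calc (killedAvg H J)^[k + l] f x ≤ C / √l * m k := hspread k l (hk.trans hln) x
      _ ≤ C / √k * (D / √k) := by
          gcongr
          · exact hm0 k
          · exact hD k hk
      _ = C * D / k := by
          rw [div_mul_div_comm, Real.mul_self_sqrt hk0.le]
      _ ≤ (2 * |K| + 6 * (C * D)) / ((k + l : ℕ) + 1) := by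
          rw [div_le_div_iff₀ hk0 (by positivity)]
          have h6 : ((k + l : ℕ) : ℝ) + 1 ≤ 6 * k := by
            rw [hkl]; exact_mod_cast hl
          have hCD : 0 ≤ C * D := by positivity
          nlinarith [mul_nonneg hK0 hk0.le, mul_le_mul_of_nonneg_left h6 hCD]

/-! ### Killed averaging as a bounded operator -/

/-- The density is positive everywhere, so the two measures have the same null sets. -/
lemma ae_weightedMeasure : ae weightedMeasure = ae (volume : Measure ℝ) := by
  refine le_antisymm (withDensity_absolutelyContinuous _ _).ae_le
    (withDensity_absolutelyContinuous' (by fun_prop) ?_).ae_le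
  refine Eventually.of_forall fun x => ?_
  simp only [ne_eq, ENNReal.ofReal_eq_zero, not_le]
  positivity

lemma integrable_weightedMeasure_iff {g : ℝ → ℝ} :
    Integrable g weightedMeasure ↔ Integrable fun x => g x * (1 + x ^ 2) := by
  rw [weightedMeasure, integrable_withDensity_iff_integrable_smul' (by fun_prop) (by simp)]
  refine integrable_congr (Eventually.of_forall fun x => ?_)
  simp only [smul_eq_mul]
  rw [ENNReal.toReal_ofReal (by positivity), mul_comm]

lemma integral_weightedMeasure (g : ℝ → ℝ) :
    ∫ x, g x ∂weightedMeasure = ∫ x, g x * (1 + x ^ 2) := by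
  rw [weightedMeasure, integral_withDensity_eq_integral_toReal_smul (by fun_prop) (by simp)]
  refine integral_congr_ae (Eventually.of_forall fun x => ?_)
  simp only [smul_eq_mul]
  rw [ENNReal.toReal_ofReal (by positivity), mul_comm]

lemma integrable_moment (g : WeightedL1) : Integrable fun x => g x * (1 + x ^ 2) :=
  integrable_weightedMeasure_iff.1 (L1.integrable_coeFn g)

lemma norm_eq_integral_moment (g : WeightedL1) : ‖g‖ = ∫ x, |g x| * (1 + x ^ 2) := by
  rw [L1.norm_eq_integral_norm, integral_weightedMeasure]
  simp only [Real.norm_eq_abs]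

/-- The killed averaging operator as a bounded operator on the weighted space. -/
lemma IsKernel.exists_killedAvgCLM (hJ : IsKernel J) (hH : IsHole H) :
    ∃ T : WeightedL1 →L[ℝ] WeightedL1, ∀ g : WeightedL1, T g =ᵐ[volume] killedAvg H J g := by
  have hint : ∀ g : WeightedL1, Integrable (killedAvg H J g) weightedMeasure := fun g =>
    integrable_weightedMeasure_iff.2 (hJ.integrable_killedAvg_moment hH (integrable_moment g))
  have hcoe : ∀ g : WeightedL1, (hint g).toL1 (killedAvg H J g) =ᵐ[volume] killedAvg H J g := by
    intro g
    have := (hint g).coeFn_toL1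
    rwa [EventuallyEq, ae_weightedMeasure] at this
  have hi : ∀ (g : WeightedL1) x, Integrable fun y => J (x - y) * g y := fun g x =>
    hJ.integrable_avg_integrand (integrable_of_integrable_mul_one_add_sq (integrable_moment g)) x
  let T₀ : WeightedL1 →ₗ[ℝ] WeightedL1 :=
    { toFun := fun g => (hint g).toL1 _
      map_add' := fun f g => by
        rw [← Integrable.toL1_add]
        refine (Integrable.toL1_eq_toL1_iff _ _ _ _).2 (Eventually.of_forall fun x => ?_)
        have hadd : ⇑(f + g) =ᵐ[volume] ⇑f + ⇑g := by
          have := Lp.coeFn_add f g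
          rwa [EventuallyEq, ae_weightedMeasure] at this
        rw [killedAvg_congr_ae hadd]
        have e : avg J (⇑f + ⇑g) = avg J f + avg J g := by
          ext x
          simp only [avg, Pi.add_apply, mul_add]
          exact integral_add (hi f x) (hi g x)
        simp only [killedAvg, e, indicator_add', Pi.add_apply]
      map_smul' := fun c f => by
        rw [RingHom.id_apply, ← Integrable.toL1_smul]
        refine (Integrable.toL1_eq_toL1_iff _ _ _ _).2 (Eventually.of_forall fun x => ?_)
        have hsmul : ⇑(c • f) =ᵐ[volume] c • ⇑f := by
          have := Lp.coeFn_smul c f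
          rwa [EventuallyEq, ae_weightedMeasure] at this
        rw [killedAvg_congr_ae hsmul]
        have e : avg J (c • ⇑f) = fun x => c • avg J f x := by
          ext x
          simp only [avg, Pi.smul_apply, smul_eq_mul]
          rw [← integral_const_mul]
          exact integral_congr_ae (Eventually.of_forall fun y => by ring)
        simp only [killedAvg, e, indicator_const_smul_apply] }
  refine ⟨T₀.mkContinuous (2 * ∫ z, J z * (1 + z ^ 2)) fun g => ?_, hcoe⟩
  rw [norm_eq_integral_moment, norm_eq_integral_moment]
  have e : ∫ x, |T₀ g x| * (1 + x ^ 2) = ∫ x, |killedAvg H J g x| * (1 + x ^ 2) := by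
    refine integral_congr_ae ?_
    filter_upwards [hcoe g] with x hx
    rw [← hx]
    rfl
  rw [e]
  refine le_trans ?_ (hJ.integral_abs_avg_moment_le (integrable_moment g))
  have habs : ∀ {f : ℝ → ℝ}, Integrable (fun x => f x * (1 + x ^ 2)) →
      Integrable fun x => |f x| * (1 + x ^ 2) := fun hf => by
    refine hf.abs.congr (Eventually.of_forall fun x => ?_)
    simp only [abs_mul]
    rw [abs_of_nonneg (by positivity : (0 : ℝ) ≤ 1 + x ^ 2)]
  refine integral_mono (habs (hJ.integrable_killedAvg_moment hH (integrable_moment g)))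
    (habs (hJ.integrable_avg_moment (integrable_moment g))) fun x => ?_
  refine mul_le_mul_of_nonneg_right ?_ (by positivity)
  by_cases hx : x ∈ Hᶜ
  · simp only [killedAvg, indicator_of_mem hx, le_refl]
  · simp only [killedAvg, indicator_of_notMem hx, abs_zero, abs_nonneg]

lemma pow_apply_ae_eq {T : WeightedL1 →L[ℝ] WeightedL1}
    (hT : ∀ g : WeightedL1, T g =ᵐ[volume] killedAvg H J g) (g : WeightedL1) (n : ℕ) :
    (T ^ n) g =ᵐ[volume] (killedAvg H J)^[n] g := by
  induction n with
  | zero => exact EventuallyEq.rfl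
  | succ n ih =>
    rw [pow_succ', Function.iterate_succ_apply', ← killedAvg_congr_ae ih]
    exact hT _

/-! ### Exponential formula for the solution -/

/-- A differentiable curve that vanishes in the hole has a derivative that vanishes there. -/
lemma ae_eq_zero_of_hasDerivAt (hH : MeasurableSet H) {v : WeightedL1} {t : ℝ}
    (hu : ∀ᶠ s in 𝓝 t, ∀ᵐ x : ℝ, x ∈ H → u s x = 0) (hv : HasDerivAt u v t) :
    ∀ᵐ x : ℝ, x ∈ H → v x = 0 := by
  -- Restriction to the hole is continuous and linear, so it commutes with differentiation; the
  -- restricted curve vanishes near `t`, hence so does its derivative.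
  set P := LpToLpRestrictCLM ℝ ℝ ℝ weightedMeasure 1 H with hP
  have hzero : ∀ g : WeightedL1, P g = 0 ↔ ∀ᵐ x : ℝ, x ∈ H → g x = 0 := by
    intro g
    have h1 : P g =ᵐ[weightedMeasure.restrict H] g := LpToLpRestrictCLM_coeFn ℝ H g
    rw [Lp.eq_zero_iff_ae_eq_zero, ← ae_weightedMeasure, ← ae_restrict_iff' hH]
    exact ⟨fun h => h1.symm.trans h, fun h => h1.trans h⟩
  have hd : HasDerivAt (fun s => P (u s)) (P v) t := P.hasFDerivAt.comp_hasDerivAt t hv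
  have h0 : (fun s => P (u s)) =ᶠ[𝓝 t] fun _ => 0 := by
    filter_upwards [hu] with s hs
    exact (hzero _).2 hs
  exact (hzero v).1 (hd.unique ((hasDerivAt_const t _).congr_of_eventuallyEq h0))

/-- The equation is prescribed only outside the hole. Inside, both `u t` and its derivative vanish,
so the two regions combine into one linear equation in the whole space. -/
lemma IsSolution.hasDerivAt (hu : IsSolution H J u₀ u) (hH : IsHole H)
    {T : WeightedL1 →L[ℝ] WeightedL1}
    (hT : ∀ g : WeightedL1, T g =ᵐ[volume] killedAvg H J g) {t : ℝ} (ht : 0 < t) :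
    HasDerivAt u (T (u t) - u t) t := by
  obtain ⟨v, hv, hveq⟩ := hu.equation t ht
  have hv0 := ae_eq_zero_of_hasDerivAt hH.isOpen.measurableSet
    ((lt_mem_nhds ht).mono fun s hs => hu.eq_zero_hole s hs) hv
  have hvT : v = T (u t) - u t := by
    have hsub : ⇑(T (u t) - u t) =ᵐ[volume] ⇑(T (u t)) - ⇑(u t) := by
      have := Lp.coeFn_sub (T (u t)) (u t)
      rwa [EventuallyEq, ae_weightedMeasure] at this
    refine Lp.ext ?_
    rw [EventuallyEq, ae_weightedMeasure]
    filter_upwards [hveq, hv0, hu.eq_zero_hole t ht, hT (u t), hsub] with x h1 h2 h3 h4 h5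
    rw [h5, Pi.sub_apply, h4, killedAvg]
    by_cases hx : x ∈ H
    · rw [h2 hx, h3 hx, indicator_of_notMem (notMem_compl_iff.2 hx), sub_zero]
    · rw [h1 hx, indicator_of_mem (mem_compl hx)]
      rfl
  rwa [hvT] at hv

/-- The solution of a linear equation in a Banach space is given by the exponential. -/
lemma eq_exp_smul_apply {E : Type*} [NormedAddCommGroup E] [NormedSpace ℝ E] [CompleteSpace E]
    {T : E →L[ℝ] E} {w : ℝ → E} (hc : ContinuousOn w (Ici 0))
    (hd : ∀ t, 0 < t → HasDerivAt w (T (w t)) t) {t : ℝ} (ht : 0 ≤ t) :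
    w t = NormedSpace.exp (t • T) (w 0) := by
  -- This curve joins `exp (t • T) (w 0)` at `s = 0` to `w t` at `s = t`, and the two terms of its
  -- derivative cancel.
  set g : ℝ → E := fun s => NormedSpace.exp ((t - s) • T) (w s) with hg
  have hexp : ∀ s, HasDerivAt (fun s : ℝ => NormedSpace.exp ((t - s) • T))
      (-(NormedSpace.exp ((t - s) • T) * T)) s := by
    intro s
    have h := (hasDerivAt_exp_smul_const (𝕂 := ℝ) T (t - s)).scomp s
      ((hasDerivAt_id s).const_sub t)
    exact h.congr_deriv (by simp)
  have hgc : ContinuousOn g (Icc 0 t) := by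
    have h1 : Continuous fun s : ℝ => NormedSpace.exp ((t - s) • T) :=
      continuous_iff_continuousAt.2 fun s => (hexp s).continuousAt
    exact h1.continuousOn.clm_apply (hc.mono Icc_subset_Ici_self)
  have hgd : ∀ s, 0 < s → HasDerivAt g 0 s := by
    intro s hs
    have h := (hexp s).clm_apply (hd s hs)
    simpa using h
  have hconst : ∀ s ∈ Ioc 0 t, g s = g t := by
    intro s hs
    refine (constant_of_has_deriv_right_zero (hgc.mono (Icc_subset_Icc_left hs.1.le))
      (fun r hr => (hgd r (hs.1.trans_le hr.1)).hasDerivWithinAt) t ⟨hs.2, le_rfl⟩).symm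
  rcases ht.eq_or_lt with rfl | ht
  · simp
  -- The equation holds only for positive times, so constancy is extended to `s = 0` by continuity.
  · have hlim : Tendsto g (𝓝[>] 0) (𝓝 (g 0)) :=
      (hgc 0 ⟨le_rfl, ht.le⟩).mono_left (nhdsWithin_le_of_mem (mem_of_superset
        (Ioc_mem_nhdsGT ht) Ioc_subset_Icc_self))
    have hlim' : Tendsto g (𝓝[>] 0) (𝓝 (g t)) := by
      refine tendsto_const_nhds.congr' ?_
      filter_upwards [Ioc_mem_nhdsGT ht] with s hs
      exact (hconst s hs).symm
    have := tendsto_nhds_unique hlim' hlim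
    simpa [hg] using this

/-- The solution is the Poisson average of the iterates of the killed averaging operator. -/
lemma IsSolution.hasSum (hu : IsSolution H J u₀ u) (hH : IsHole H)
    {T : WeightedL1 →L[ℝ] WeightedL1}
    (hT : ∀ g : WeightedL1, T g =ᵐ[volume] killedAvg H J g) {t : ℝ} (ht : 0 ≤ t) :
    HasSum (fun n : ℕ => (rexp (-t) * (t ^ n / n.factorial)) • (T ^ n) (u 0)) (u t) := by
  have hexp : ∀ s : ℝ, HasDerivAt (fun s => rexp s) (rexp s) s := Real.hasDerivAt_exp
  -- The factor `e^s` absorbs the term `-u`, leaving `w' = T w`.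
  have h := eq_exp_smul_apply (T := T) (w := fun s => rexp s • u s)
    (Real.continuous_exp.continuousOn.smul hu.continuousOn) (fun s hs => by
      refine ((hexp s).smul (hu.hasDerivAt hH hT hs)).congr_deriv ?_
      rw [map_smul, smul_sub, sub_add_cancel]) ht
  simp only [Real.exp_zero, one_smul] at h
  have h2 : u t = rexp (-t) • NormedSpace.exp (t • T) (u 0) := by
    rw [← h, smul_smul, ← Real.exp_add]
    simp
  have hs : HasSum (fun n : ℕ => (n.factorial⁻¹ : ℝ) • (t • T) ^ n) (NormedSpace.exp (t • T)) :=
    NormedSpace.exp_series_hasSum_exp' (𝕂 := ℝ) _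
  rw [h2]
  refine (((ContinuousLinearMap.apply ℝ WeightedL1 (u 0)).hasSum hs).const_smul
    (rexp (-t))).congr_fun ?_
  intro n
  simp [smul_pow, smul_smul, div_eq_inv_mul]

/-! ### Uniform bound for the Poisson average -/

/-- Almost everywhere bounds pass to limits in the weighted space. -/
lemma ae_mem_Icc_of_tendsto {g : ℕ → WeightedL1} {h : WeightedL1} {c : ℝ}
    (hlim : Tendsto g atTop (𝓝 h)) (hg : ∀ n, ∀ᵐ x : ℝ, g n x ∈ Icc 0 c) :
    ∀ᵐ x : ℝ, h x ∈ Icc 0 c := by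
  -- Norm convergence gives convergence in measure, hence convergence almost everywhere along a
  -- subsequence.
  obtain ⟨ns, -, hns⟩ := (tendstoInMeasure_of_tendsto_Lp hlim).exists_seq_tendsto_ae
  rw [ae_weightedMeasure] at hns
  filter_upwards [hns, ae_all_iff.2 hg] with x hx hgx
  exact isClosed_Icc.mem_of_tendsto hx (Eventually.of_forall fun k => hgx _)

/-- The factor `1 / (n + 1)` completes `n!` to `(n + 1)!` and shifts the exponential series by one
index at the price of `1 / t`. -/
lemma sum_pow_div_factorial_mul_le {C t : ℝ} (hC : 0 ≤ C) (ht : 0 < t) (N : ℕ) :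
    ∑ n ∈ Finset.range N, rexp (-t) * (t ^ n / n.factorial) * (C / (n + 1)) ≤ C / t := by
  have e : ∀ n : ℕ, rexp (-t) * (t ^ n / n.factorial) * (C / (n + 1))
      = C / t * rexp (-t) * (t ^ (n + 1) / (n + 1).factorial) := by
    intro n
    rw [Nat.factorial_succ]
    push_cast
    field_simp
    ring
  simp_rw [e]
  rw [← Finset.mul_sum]
  have h1 : ∑ n ∈ Finset.range N, t ^ (n + 1) / ((n + 1).factorial : ℝ) ≤ rexp t := by
    refine le_trans ?_ (Real.sum_le_exp_of_nonneg ht.le (N + 1))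
    rw [Finset.sum_range_succ']
    exact le_add_of_nonneg_right (by positivity)
  calc C / t * rexp (-t) * ∑ n ∈ Finset.range N, t ^ (n + 1) / ((n + 1).factorial : ℝ)
      ≤ C / t * rexp (-t) * rexp t := by gcongr
    _ = C / t := by rw [mul_assoc, ← Real.exp_add]; simp

lemma IsSolution.isAdmissible_initial (hu : IsSolution H J u₀ u) (hu₀ : IsInitialDatum H u₀) :
    IsAdmissible H (u 0) where
  nonneg := by
    filter_upwards [hu.initial, hu₀.nonneg] with x h1 h2
    rwa [h1]
  eq_zero := by
    filter_upwards [hu.initial, hu₀.eq_zero_hole] with x h1 h2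
    rwa [h1]
  moment := integrable_moment _

lemma IsSolution.exists_ae_initial_le (hu : IsSolution H J u₀ u) (hu₀ : IsInitialDatum H u₀) :
    ∃ K : ℝ, ∀ᵐ x : ℝ, u 0 x ≤ K := by
  have hfin : eLpNormEssSup u₀ volume ≠ ⊤ := by
    rw [← eLpNorm_exponent_top]
    exact hu₀.memLp_top.2.ne
  refine ⟨(eLpNormEssSup u₀ volume).toReal, ?_⟩
  filter_upwards [hu.initial, ae_le_eLpNormEssSup (f := u₀) (μ := volume)] with x h1 h2
  rw [h1]
  refine (le_abs_self _).trans ?_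
  have := ENNReal.toReal_mono hfin h2
  simpa using this

end NonlocalHole

theorem theorem4p1 (H : Set ℝ) (J u₀ : ℝ → ℝ)
    (hH : NonlocalHole.IsHole H) (hJ : NonlocalHole.IsKernel J)
    (hu₀ : NonlocalHole.IsInitialDatum H u₀)
    (u : ℝ → NonlocalHole.WeightedL1) (hu : NonlocalHole.IsSolution H J u₀ u) :
    ∃ C : ℝ, ∀ t : ℝ, 0 < t →
      MeasureTheory.eLpNorm (u t : ℝ → ℝ) ⊤ MeasureTheory.volume ≤ ENNReal.ofReal (C / t) := by
  obtain ⟨T, hT⟩ := hJ.exists_killedAvgCLM hH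
  obtain ⟨K, hK⟩ := hu.exists_ae_initial_le hu₀
  have hadm := hu.isAdmissible_initial hu₀
  obtain ⟨C, hC, hdecay⟩ := hJ.exists_killedAvg_iterate_le hH hadm hK
  refine ⟨C, fun t ht => ?_⟩
  -- Partial sums are kept in a closed interval starting at zero: the condition passes to the limit,
  -- and nonnegativity turns the upper bound into a bound on the absolute value.
  have hpart : ∀ N : ℕ, ∀ᵐ x : ℝ, (∑ n ∈ Finset.range N,
      (Real.exp (-t) * (t ^ n / n.factorial)) • (T ^ n) (u 0) : NonlocalHole.WeightedL1) x
        ∈ Icc 0 (C / t) := by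
    intro N
    have hbd : ∀ᵐ x : ℝ, (∑ n ∈ Finset.range N,
        (Real.exp (-t) * (t ^ n / n.factorial)) • (T ^ n) (u 0) : NonlocalHole.WeightedL1) x
          ∈ Icc 0 (∑ n ∈ Finset.range N,
            Real.exp (-t) * (t ^ n / n.factorial) * (C / (n + 1))) := by
      induction N with
      | zero =>
        have h0 := Lp.coeFn_zero ℝ 1 NonlocalHole.weightedMeasure
        rw [Filter.EventuallyEq, NonlocalHole.ae_weightedMeasure] at h0
        filter_upwards [h0] with x hx
        rw [Finset.range_zero, Finset.sum_empty, Finset.sum_empty, hx]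
        simp
      | succ N ih =>
        rw [Finset.sum_range_succ, Finset.sum_range_succ]
        set S : NonlocalHole.WeightedL1 := ∑ n ∈ Finset.range N,
          (Real.exp (-t) * (t ^ n / n.factorial)) • (T ^ n) (u 0)
        have h1 := Lp.coeFn_add S ((Real.exp (-t) * (t ^ N / N.factorial)) • (T ^ N) (u 0))
        have h2 := Lp.coeFn_smul (Real.exp (-t) * (t ^ N / N.factorial)) ((T ^ N) (u 0))
        rw [Filter.EventuallyEq, NonlocalHole.ae_weightedMeasure] at h1 h2
        filter_upwards [h1, h2, ih, NonlocalHole.pow_apply_ae_eq hT (u 0) N, hdecay N,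
          (hJ.isAdmissible_killedAvg_iterate hH hadm N).nonneg] with x h1 h2 h3 h4 h5 h6
        rw [h1, Pi.add_apply, h2, Pi.smul_apply, h4, smul_eq_mul]
        exact ⟨add_nonneg h3.1 (by positivity), add_le_add h3.2 (by gcongr)⟩
    filter_upwards [hbd] with x hx
    exact ⟨hx.1, hx.2.trans (NonlocalHole.sum_pow_div_factorial_mul_le hC ht N)⟩
  have hmem := NonlocalHole.ae_mem_Icc_of_tendsto (hu.hasSum hH hT ht.le).tendsto_sum_nat hpart
  rw [eLpNorm_exponent_top]
  refine eLpNormEssSup_le_of_ae_bound ?_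
  filter_upwards [hmem] with x hx
  rw [Real.norm_of_nonneg hx.1]
  exact hx.2
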